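/- Let $\mathbb{D}$ be the unit disc of $\mathbb{C}$ and $dA=\frac{dx\,dy}{\pi}$. A radial weight is an integrable function $\omega:\mathbb{D}\to[0,\infty)$ with $\omega(z)=\omega(|z|)$; put $\widehat\omega(t)=\int_t^1\omega(s)\,ds$. Write $\omega\in\widehat{\mathcal D}$ if $\omega$ is a radial weight with $\widehat\omega(t)>0$ for all $0\le t<1$ and there is $C\ge1$ such that $\widehat\omega(t)\le C\,\widehat\omega(\frac{1+t}{2})$ for all $0\le t<1$. For $0<p<\infty$, the Bergman space $A^p_\omega$ consists of the analytic functions $f$ in $\mathbb{D}$ with $\|f\|_{A^p_\omega}^p=\int_{\mathbb{D}}|f|^p\omega\,dA<\infty$. A measurable set $G\subset\mathbb{D}$ is a dominating set for $f\in A^p_\omega$ if there is $\delta>0$ such that $\int_G|f|^p\omega\,dA\ge\delta\|f\|^p_{A^p_\omega}$. Let $\Delta(z,r)=\{\zeta\in\mathbb{D}:|\frac{z-\zeta}{1-\overline{z}\zeta}|<r\}$ be the pseudohyperbolic disc. Let $\omega\in\widehat{\mathcal D}$ and $0<r<1$. For $0<p<\infty$, $f\in A^p_\omega$, $\varepsilon>0$,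 a positive Borel measure $\nu$ on $\mathbb{D}$ and measurable sets $E(z)\subset\Delta(z,r)$ with $\nu(E(z))>0$ for all $z\in\mathbb{D}$, define $$Q(f)(z)=\frac{1}{\nu(E(z))}\int_{E(z)}|f(\zeta)|^p\,d\nu(\zeta),\qquad E=\{z\in\mathbb{D}:|f(z)|^p\le\varepsilon\,Q(f)(z)\},$$ with the conventions $1/\infty=0$ and $0\cdot\infty=0$, and suppose that $E$ is measurable. Then there exists a constant $C=C(r,\omega)>0$, depending only on $r$ and $\omega$, such that $$\int_E|f(z)|^p\omega(z)\,dA(z)\le C\varepsilon\|f\|^p_{A^p_\omega}$$ for all such $p$, $f$, $\varepsilon$, $\nu$ and $E(\cdot)$. Moreover, there exists $\varepsilon_0=\varepsilon_0(r,\omega)>0$ such that, whenever $0<\varepsilon\le\varepsilon_0$, the set $\mathbb{D}\setminus E$ is a dominating set for $f$. -/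

import Mathlib

open MeasureTheory
open scoped ENNReal

noncomputable section

namespace WeightedBergman

/-- The open unit disc. -/
def unitDisc : Set ℂ := Metric.ball 0 1

/-- The normalized area measure `dA = dx dy / π` on the unit disc. -/
def discArea : Measure ℂ :=
  ENNReal.ofReal (Real.pi⁻¹) • (volume : Measure ℂ).restrict unitDisc

/-- A weight: a nonnegative integrable function on the unit disc. Functions on the disc are
represented by functions on `ℂ` whose values outside the disc are irrelevant. -/
structure IsWeight (ω : ℂ → ℝ) : Prop where
  nonneg : ∀ z ∈ unitDisc, 0 ≤ ω z
  integrable : Integrable ω discArea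

/-- A weight is radial if `ω z = ω |z|` on the disc. -/
def IsRadial (ω : ℂ → ℝ) : Prop :=
  ∀ z ∈ unitDisc, ω z = ω (‖z‖ : ℂ)

/-- The tail `ω̂(t) = ∫_t^1 ω(s) ds` of a radial weight, with values in `[0, ∞]`. -/
def tail (ω : ℂ → ℝ) (t : ℝ) : ℝ≥0∞ :=
  ∫⁻ s in Set.Ioo t 1, ENNReal.ofReal (ω (s : ℂ))

/-- The class `D̂` of radial weights with positive tail such that
`ω̂(t) ≤ C ω̂((1+t)/2)` for all `0 ≤ t < 1`. -/
structure MemDHat (ω : ℂ → ℝ) : Prop where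
  isWeight : IsWeight ω
  isRadial : IsRadial ω
  tail_pos : ∀ t : ℝ, 0 ≤ t → t < 1 → 0 < tail ω t
  doubling : ∃ C : ℝ, 1 ≤ C ∧
    ∀ t : ℝ, 0 ≤ t → t < 1 → tail ω t ≤ ENNReal.ofReal C * tail ω ((1 + t) / 2)

/-- `∫_G |f|^p ω dA`, with values in `[0, ∞]`; only the part of `G` in the disc matters. -/
def integralOver (p : ℝ) (ω : ℂ → ℝ) (f : ℂ → ℂ) (G : Set ℂ) : ℝ≥0∞ :=
  ∫⁻ z in G, ‖f z‖ₑ ^ p * ENNReal.ofReal (ω z) ∂discArea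

/-- The `p`-th power `‖f‖^p` of the Bergman norm. -/
def normPow (p : ℝ) (ω : ℂ → ℝ) (f : ℂ → ℂ) : ℝ≥0∞ :=
  integralOver p ω f unitDisc

/-- Membership in the weighted Bergman space `A^p_ω`. -/
structure MemBergman (p : ℝ) (ω : ℂ → ℝ) (f : ℂ → ℂ) : Prop where
  analytic : DifferentiableOn ℂ f unitDisc
  norm_finite : normPow p ω f < ∞

/-- The pseudohyperbolic disc `Δ(z, r)`. -/
def pseudoDisc (z : ℂ) (r : ℝ) : Set ℂ :=
  {w ∈ unitDisc | ‖(z - w) / (1 - (starRingEnd ℂ) z * w)‖ < r}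

/-- Measurable sets `S z ⊆ Δ(z, r)`, `z` in the disc, with `ν (S z) > 0`. -/
structure IsAveragingFamily (r : ℝ) (ν : Measure ℂ) (S : ℂ → Set ℂ) : Prop where
  measurable : ∀ z ∈ unitDisc, NullMeasurableSet (S z) ν
  subset : ∀ z ∈ unitDisc, S z ⊆ pseudoDisc z r
  pos : ∀ z ∈ unitDisc, 0 < ν (S z)

/-- `Q(f)(z)`, the `ν`-average of `|f|^p` over `S z`. -/
def average (p : ℝ) (ν : Measure ℂ) (S : ℂ → Set ℂ) (f : ℂ → ℂ) (z : ℂ) : ℝ≥0∞ :=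
  (ν (S z))⁻¹ * ∫⁻ ζ in S z, ‖f ζ‖ₑ ^ p ∂ν

/-- The set of the points `z` of the disc with `|f(z)|^p ≤ ε Q(f)(z)`. -/
def badSet (p : ℝ) (ν : Measure ℂ) (S : ℂ → Set ℂ) (ε : ℝ) (f : ℂ → ℂ) : Set ℂ :=
  {z ∈ unitDisc | ‖f z‖ₑ ^ p ≤ ENNReal.ofReal ε * average p ν S f z}

/-- `G` is a dominating set for `f ∈ A^p_ω`: a (Lebesgue) measurable subset of the disc with
`∫_G |f|^p ω dA ≥ δ ‖f‖^p` for some `δ > 0`. -/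
structure IsDominatingFor (p : ℝ) (ω : ℂ → ℝ) (f : ℂ → ℂ) (G : Set ℂ) : Prop where
  subset : G ⊆ unitDisc
  measurable : NullMeasurableSet G (volume : Measure ℂ)
  bound : ∃ δ : ℝ, 0 < δ ∧ ENNReal.ofReal δ * normPow p ω f ≤ integralOver p ω f G

end WeightedBergman

end

/-!
The exponent `p` and the function `f` enter only through the subharmonicity of `u = |f| ^ p`, which
is why the constants depend on `r` and `ω` alone. On `E` we have `u ≤ ε sup_{Δ(z, r)} u`, so it is
enough to bound `∫ (sup_{Δ(z, r)} u) ω dA` by a multiple of `∫ u ω dA`; if the resulting factor of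
`‖f‖ ^ p` is at most `1 / 2`, then at least half of the norm lives outside `E`.

For small `κ` and `ζ ∈ Δ(z, r)`, the disc of radius `κ (1 - |z|)` about `ζ` is contained in a disc
of comparable radius about `z` and in the disc of radius `1 - κ (1 - |z|)` about the origin. Hence
the sub-mean value property bounds `sup_{Δ(z, r)} u` by local area means of `u`. Averaging over
`|z| = s`, and using that the means of `u` over centred circles increase with the radius, one
bounds the circle mean of the supremum at radius `s` by that of `u` at radius `1 - κ (1 - s)`.
For `κ = 2 ^ (-n)` the latter radius is reached from `s` in `n` steps `s ↦ (1 + s) / 2`, and each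
step costs a constant factor in the integral against `ω`: the superlevel sets of an increasing
function are intervals with endpoint `1`, on which the weight is doubling.
-/

namespace WeightedBergman

open Metric Set Real Filter
open scoped NNReal

/-- The uniform probability measure on the angles in `(-π, π)`. -/
noncomputable def angleMeasure : Measure ℝ :=
  ProbabilityTheory.cond volume (Ioo (-π) π)

/-- The mean value of `u : ℂ → [0, ∞]` over the circle of centre `c` and radius `R`. Unlike
`Real.circleAverage` it is meaningful without any integrability. -/
noncomputable def circleMean (u : ℂ → ℝ≥0∞) (c : ℂ) (R : ℝ) : ℝ≥0∞ :=
  ∫⁻ θ, u (circleMap c R θ) ∂angleMeasure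

section CircleMean

instance : IsProbabilityMeasure angleMeasure :=
  ProbabilityTheory.cond_isProbabilityMeasure_of_finite (by simp [pi_pos]) (by simp)

theorem angleMeasure_eq_smul :
    angleMeasure = (ENNReal.ofReal (2 * π))⁻¹ • volume.restrict (Ioo (-π) π) := by
  rw [angleMeasure, ProbabilityTheory.cond, Real.volume_Ioo, sub_neg_eq_add, two_mul]

theorem lintegral_angleMeasure_comp_add {g : ℝ → ℝ≥0∞} (hg : g.Periodic (2 * π)) (φ : ℝ) :
    ∫⁻ θ, g (θ + φ) ∂angleMeasure = ∫⁻ θ, g θ ∂angleMeasure := by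
  have hshift : ∫⁻ θ in Ioc (-π) (-π + 2 * π), g (θ + φ) =
      ∫⁻ θ in Ioc (-π + φ) (-π + φ + 2 * π), g θ := by
    rw [← (measurePreserving_add_right volume φ).setLIntegral_comp_preimage_emb
      (measurableEmbedding_addRight φ) g, preimage_add_const_Ioc]
    ring_nf
  have hperiod : ∫⁻ θ in Ioc (-π + φ) (-π + φ + 2 * π), g θ =
      ∫⁻ θ in Ioc (-π) (-π + 2 * π), g θ :=
    (isAddFundamentalDomain_Ioc two_pi_pos _).setLIntegral_eq
      (isAddFundamentalDomain_Ioc two_pi_pos _) g fun a θ => by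
        obtain ⟨n, hn⟩ := AddSubgroup.mem_zmultiples_iff.1 a.2
        rw [AddSubgroup.vadd_def, vadd_eq_add, ← hn, add_comm, hg.zsmul n θ]
  have hpi : -π + 2 * π = π := by ring
  rw [hpi] at hshift hperiod
  simp only [angleMeasure_eq_smul, lintegral_smul_measure,
    Measure.restrict_congr_set Ioo_ae_eq_Ioc, hshift, hperiod]

theorem circleMean_const (a : ℝ≥0∞) (c : ℂ) (R : ℝ) : circleMean (fun _ => a) c R = a := by
  simp [circleMean]

theorem circleMean_mono {u v : ℂ → ℝ≥0∞} {c : ℂ} {R : ℝ} (h : ∀ z ∈ sphere c |R|, u z ≤ v z) :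
    circleMean u c R ≤ circleMean v c R :=
  lintegral_mono fun θ => h _ (circleMap_mem_sphere' c R θ)

theorem circleMean_comp_mul (u : ℂ → ℝ≥0∞) (c : ℂ) (R : ℝ) {a : ℂ} (ha : ‖a‖ = 1) :
    circleMean (fun z => u (a * z)) c R = circleMean u (a * c) R := by
  obtain ⟨φ, rfl⟩ := (Complex.norm_eq_one_iff a).1 ha
  have hper : (fun θ => u (circleMap (Complex.exp (φ * Complex.I) * c) R θ)).Periodic (2 * π) :=
    fun θ => by simp only [periodic_circleMap _ R θ]
  rw [circleMean, circleMean, ← lintegral_angleMeasure_comp_add hper φ]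
  refine lintegral_congr fun θ => congrArg u ?_
  simp only [circleMap, Complex.ofReal_add, add_mul, Complex.exp_add]
  ring

theorem circleMean_zero_norm_eq (u : ℂ → ℝ≥0∞) (w : ℂ) :
    circleMean u 0 ‖w‖ = circleMean (fun ζ => u (ζ * w)) 0 1 := by
  have hper : (fun θ => u (circleMap 0 ‖w‖ θ)).Periodic (2 * π) :=
    fun θ => by simp only [periodic_circleMap _ _ θ]
  rw [circleMean, circleMean, ← lintegral_angleMeasure_comp_add hper w.arg]
  refine lintegral_congr fun θ => congrArg u ?_
  simp only [circleMap, Complex.ofReal_add, add_mul, Complex.exp_add, Complex.ofReal_one]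
  linear_combination Complex.exp (θ * Complex.I) * Complex.norm_mul_exp_arg_mul_I w

end CircleMean

section PolarCoordinates

theorem lintegral_prod_circleMap (g : ℂ → ℝ≥0∞) (c : ℂ) (R : ℝ) :
    ENNReal.ofReal (2 * π) * ∫⁻ q, ENNReal.ofReal q.1 * g (circleMap c q.1 q.2)
      ∂((volume.restrict (Ioo 0 R)).prod angleMeasure) = ∫⁻ z in ball c R, g z := by
  have hball : ∀ q ∈ Ioi (0 : ℝ) ×ˢ Ioo (-π) π,
      ENNReal.ofReal q.1 • (ball c R).indicator g (c + Complex.polarCoord.symm q) =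
        (Ioo 0 R ×ˢ Ioo (-π) π).indicator
          (fun q => ENNReal.ofReal q.1 * g (circleMap c q.1 q.2)) q := by
    rintro ⟨s, θ⟩ ⟨hs, hθ⟩
    have hpolar : c + Complex.polarCoord.symm (s, θ) = circleMap c s θ := by
      simp [Complex.polarCoord_symm_apply, circleMap, Complex.exp_mul_I]
    have hmem : circleMap c s θ ∈ ball c R ↔ (s, θ) ∈ Ioo 0 R ×ˢ Ioo (-π) π := by
      simp [hθ.1, hθ.2, mem_Ioi.1 hs, abs_of_pos (mem_Ioi.1 hs), dist_eq_norm]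
    by_cases hq : (s, θ) ∈ Ioo 0 R ×ˢ Ioo (-π) π
    · rw [hpolar, indicator_of_mem hq, indicator_of_mem (hmem.2 hq), smul_eq_mul]
    · rw [hpolar, indicator_of_notMem hq, indicator_of_notMem (mt hmem.1 hq), smul_zero]
  rw [← lintegral_indicator measurableSet_ball, ← lintegral_add_left_eq_self _ c,
    ← Complex.lintegral_comp_polarCoord_symm, polarCoord_target,
    setLIntegral_congr_fun (measurableSet_Ioi.prod measurableSet_Ioo) hball,
    lintegral_indicator (measurableSet_Ioo.prod measurableSet_Ioo),
    Measure.restrict_restrict_of_subset (prod_mono_left Ioo_subset_Ioi_self),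
    angleMeasure_eq_smul, Measure.prod_smul_right, lintegral_smul_measure, smul_eq_mul, ← mul_assoc,
    ENNReal.mul_inv_cancel (by simp [pi_pos]) ENNReal.ofReal_ne_top, one_mul,
    Measure.prod_restrict, Measure.volume_eq_prod]

theorem quasiMeasurePreserving_circleMap (c : ℂ) (R : ℝ) :
    Measure.QuasiMeasurePreserving (fun q : ℝ × ℝ => circleMap c q.1 q.2)
      ((volume.restrict (Ioo 0 R)).prod angleMeasure) (volume.restrict (ball c R)) := by
  have hmeas : Measurable fun q : ℝ × ℝ => circleMap c q.1 q.2 := circleMap.continuous.measurable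
  refine ⟨hmeas, Measure.AbsolutelyContinuous.mk fun N hN hN0 => ?_⟩
  have hpos : ∀ᵐ q ∂(volume.restrict (Ioo 0 R)).prod angleMeasure, 0 < q.1 :=
    Measure.quasiMeasurePreserving_fst.ae <|
      (ae_restrict_mem measurableSet_Ioo).mono fun s hs => hs.1
  have hzero := lintegral_prod_circleMap (N.indicator 1) c R
  rw [lintegral_indicator_one hN, hN0, mul_eq_zero, or_iff_right (by simp [pi_pos]),
    lintegral_eq_zero_iff (by fun_prop (disch := assumption))] at hzero
  rw [Measure.map_apply hmeas hN, measure_eq_zero_iff_ae_notMem]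
  filter_upwards [hzero, hpos] with q hq hq0 hqN
  simp [indicator_of_mem (mem_preimage.1 hqN), hq0.not_ge] at hq

theorem setLIntegral_ball_le_circleMean (g : ℂ → ℝ≥0∞) (c : ℂ) (R : ℝ) :
    ∫⁻ z in ball c R, g z ≤
      ENNReal.ofReal (2 * π) * ∫⁻ s in Ioo 0 R, ENNReal.ofReal s * circleMean g c s := by
  rw [← lintegral_prod_circleMap]
  gcongr
  refine (lintegral_prod_le _).trans_eq (lintegral_congr fun s => ?_)
  rw [lintegral_const_mul' _ _ ENNReal.ofReal_ne_top, circleMean]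

theorem setLIntegral_ball_eq_circleMean {g : ℂ → ℝ≥0∞} {c : ℂ} {R : ℝ}
    (hg : AEMeasurable g (volume.restrict (ball c R))) :
    ∫⁻ z in ball c R, g z =
      ENNReal.ofReal (2 * π) * ∫⁻ s in Ioo 0 R, ENNReal.ofReal s * circleMean g c s := by
  have hg' : AEMeasurable (fun q : ℝ × ℝ => g (circleMap c q.1 q.2))
      ((volume.restrict (Ioo 0 R)).prod angleMeasure) :=
    hg.comp_quasiMeasurePreserving (quasiMeasurePreserving_circleMap c R)
  rw [← lintegral_prod_circleMap, lintegral_prod (fun q => _ * g (circleMap c q.1 q.2))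
    (measurable_fst.ennreal_ofReal.aemeasurable.mul hg')]
  simp_rw [lintegral_const_mul' _ _ ENNReal.ofReal_ne_top, circleMean]

end PolarCoordinates

section Semicontinuity

variable {X Y : Type*} [TopologicalSpace X] [TopologicalSpace Y]

theorem measurable_comp_of_upperSemicontinuousOn [MeasurableSpace X] [OpensMeasurableSpace X]
    {u : Y → ℝ≥0∞} {U : Set Y} (hu : UpperSemicontinuousOn u U) {g : X → Y} (hg : Continuous g)
    (hgU : ∀ x, g x ∈ U) : Measurable fun x => u (g x) :=
  (upperSemicontinuousOn_univ_iff.1 <|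
    hu.comp hg.continuousOn fun x _ => hgU x).measurable

theorem upperSemicontinuousOn_lintegral [FirstCountableTopology X] {Θ : Type*}
    [MeasurableSpace Θ] {μ : Measure Θ} [IsFiniteMeasure μ] {K : Set X} {F : X → Θ → ℝ≥0∞}
    {M : ℝ≥0∞} (hM : M ≠ ∞) (hbound : ∀ x ∈ K, ∀ θ, F x θ ≤ M)
    (hmeas : ∀ x ∈ K, Measurable (F x)) (husc : ∀ θ, UpperSemicontinuousOn (F · θ) K) :
    UpperSemicontinuousOn (fun x => ∫⁻ θ, F x θ ∂μ) K := by
  refine semicontinuousOn_iff_frequently.2 fun x hx y hfreq hlt => ?_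
  obtain ⟨ξ, hξ, hyξ⟩ := exists_seq_forall_of_frequently
    (hfreq.and_eventually self_mem_nhdsWithin)
  refine hlt.not_ge ?_
  calc y ≤ limsup (fun n => ∫⁻ θ, F (ξ n) θ ∂μ) atTop :=
        le_limsup_of_frequently_le (Frequently.of_forall fun n => not_lt.1 (hyξ n).1)
    _ ≤ ∫⁻ θ, limsup (fun n => F (ξ n) θ) atTop ∂μ :=
        limsup_lintegral_le (fun _ => M) (fun n => hmeas _ (hyξ n).2)
          (fun n => ae_of_all _ (hbound _ (hyξ n).2))
          (by simp [ENNReal.mul_ne_top hM (measure_ne_top μ univ)])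
    _ ≤ ∫⁻ θ, F x θ ∂μ := lintegral_mono fun θ =>
        (limsup_le_limsup_of_le hξ).trans ((husc θ).limsup_le x hx)

end Semicontinuity

/-- Finite-valued, nonnegative subharmonic functions on a set `U`, with values in `[0, ∞]` so that
they can be integrated without integrability conditions: upper semicontinuous functions which are
at most their mean over the boundary of every closed disc contained in `U`. -/
structure IsSubharmonicOn (u : ℂ → ℝ≥0∞) (U : Set ℂ) : Prop where
  upperSemicontinuousOn : UpperSemicontinuousOn u U
  ne_top : ∀ z ∈ U, u z ≠ ∞
  le_circleMean : ∀ c R, 0 < R → closedBall c R ⊆ U → u c ≤ circleMean u c R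

namespace IsSubharmonicOn

variable {u : ℂ → ℝ≥0∞} {U V : Set ℂ}

theorem mono (hu : IsSubharmonicOn u U) (hVU : V ⊆ U) : IsSubharmonicOn u V where
  upperSemicontinuousOn := hu.upperSemicontinuousOn.mono hVU
  ne_top z hz := hu.ne_top z (hVU hz)
  le_circleMean c R hR hcR := hu.le_circleMean c R hR (hcR.trans hVU)

theorem exists_bound {K : Set ℂ} (hu : IsSubharmonicOn u K) (hK : IsCompact K) :
    ∃ M, M ≠ ∞ ∧ ∀ z ∈ K, u z ≤ M := by
  rcases K.eq_empty_or_nonempty with rfl | hne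
  · exact ⟨0, ENNReal.zero_ne_top, by simp⟩
  obtain ⟨m, hm, hmax⟩ := hu.upperSemicontinuousOn.exists_isMaxOn hne hK
  exact ⟨u m, hu.ne_top m hm, fun z hz => hmax hz⟩

theorem measurable_indicator (hu : IsSubharmonicOn u U) (hU : MeasurableSet U) :
    Measurable (U.indicator u) := by
  have hin : U.domRestrict (U.indicator u) = fun z : U => u z :=
    funext fun z => indicator_of_mem z.2 u
  have hout : Uᶜ.domRestrict (U.indicator u) = fun _ => 0 :=
    funext fun z => indicator_of_notMem z.2 u
  refine measurable_of_restrict_of_restrict_compl hU ?_ (hout ▸ measurable_const)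
  rw [hin]
  exact measurable_comp_of_upperSemicontinuousOn hu.upperSemicontinuousOn continuous_subtype_val
    Subtype.property

theorem aemeasurable (hu : IsSubharmonicOn u U) (hU : MeasurableSet U) (μ : Measure ℂ) :
    AEMeasurable u (μ.restrict U) :=
  (aemeasurable_indicator_iff hU).1 (hu.measurable_indicator hU).aemeasurable

theorem volume_ball_mul_le {c : ℂ} {R : ℝ} (hu : IsSubharmonicOn u (ball c R)) :
    volume (ball c R) * u c ≤ ∫⁻ z in ball c R, u z := by
  calc volume (ball c R) * u c
      = ENNReal.ofReal (2 * π) *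
          ∫⁻ s in Ioo 0 R, ENNReal.ofReal s * circleMean (fun _ => u c) c s := by
        rw [← setLIntegral_ball_eq_circleMean aemeasurable_const, setLIntegral_const, mul_comm]
    _ ≤ ENNReal.ofReal (2 * π) * ∫⁻ s in Ioo 0 R, ENNReal.ofReal s * circleMean u c s := by
        refine mul_le_mul_right (setLIntegral_mono' measurableSet_Ioo fun s hs => ?_) _
        rw [circleMean_const]
        gcongr
        exact hu.le_circleMean c s hs.1 (closedBall_subset_ball hs.2)
    _ = ∫⁻ z in ball c R, u z :=
        (setLIntegral_ball_eq_circleMean (hu.aemeasurable measurableSet_ball _)).symm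

theorem eq_center_of_forall_le_center {c : ℂ} {R : ℝ} (hu : IsSubharmonicOn u (closedBall c R))
    (hR : 0 < R) (hle : ∀ z ∈ sphere c R, u z ≤ u c) : ∀ z ∈ sphere c R, u z = u c := by
  intro z hz
  rw [← abs_of_pos hR, ← range_circleMap] at hz
  obtain ⟨φ, rfl⟩ := hz
  have hmem : ∀ θ, circleMap c R θ ∈ sphere c R := circleMap_mem_sphere c hR.le
  have husc : UpperSemicontinuous fun θ => u (circleMap c R (θ + φ)) :=
    upperSemicontinuousOn_univ_iff.1 <| hu.upperSemicontinuousOn.comp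
      (g := fun θ => circleMap c R (θ + φ)) (by fun_prop)
      fun θ _ => sphere_subset_closedBall (hmem _)
  have hmean : u c ≤ ∫⁻ θ, u (circleMap c R (θ + φ)) ∂angleMeasure := by
    rw [lintegral_angleMeasure_comp_add (g := fun θ => u (circleMap c R θ))
      fun θ => by simp only [periodic_circleMap c R θ]]
    exact hu.le_circleMean c R hR Subset.rfl
  have hae : ∀ᵐ θ ∂angleMeasure, u (circleMap c R (θ + φ)) = u c := by
    refine ae_eq_of_ae_le_of_lintegral_le (ae_of_all _ fun θ => hle _ (hmem _)) ?_
      aemeasurable_const (by simpa using hmean)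
    refine ne_top_of_le_ne_top (hu.ne_top c (mem_closedBall_self hR.le)) ?_
    exact (lintegral_mono fun θ => hle _ (hmem _)).trans_eq (by simp)
  by_contra hne
  have hlt : u (circleMap c R (0 + φ)) < u c := by
    rw [zero_add]
    exact (hle _ (hmem _)).lt_of_ne hne
  have hpos := ((husc.isOpen_preimage (u c)).inter isOpen_Ioo).measure_pos volume
    ⟨0, hlt, neg_lt_zero.2 pi_pos, pi_pos⟩
  rw [angleMeasure_eq_smul,
    Measure.ae_ennreal_smul_measure_iff (ENNReal.inv_ne_zero.2 ENNReal.ofReal_ne_top),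
    ae_restrict_iff' measurableSet_Ioo] at hae
  refine hpos.ne' (measure_mono_null ?_ hae)
  exact fun θ hθ himp => hθ.1.ne (himp hθ.2)

theorem circleMean_zero_norm {R : ℝ} (hu : IsSubharmonicOn u (closedBall 0 R)) :
    IsSubharmonicOn (fun z => circleMean u 0 ‖z‖) (closedBall 0 R) := by
  have hmem : ∀ z ∈ closedBall (0 : ℂ) R, ∀ θ, circleMap 0 1 θ * z ∈ closedBall (0 : ℂ) R := by
    intro z hz θ
    simpa using hz
  obtain ⟨M, hM, hbound⟩ := hu.exists_bound (isCompact_closedBall 0 R)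
  simp only [circleMean_zero_norm_eq]
  refine ⟨?_, fun z hz => ?_, fun c s hs hcs => ?_⟩
  · refine upperSemicontinuousOn_lintegral hM (fun z hz θ => hbound _ (hmem z hz θ))
      (fun z hz => measurable_comp_of_upperSemicontinuousOn hu.upperSemicontinuousOn
        (by fun_prop) (hmem z hz)) fun θ => ?_
    exact hu.upperSemicontinuousOn.comp (g := fun z => circleMap 0 1 θ * z) (by fun_prop)
      fun z hz => hmem z hz θ
  · exact ne_top_of_le_ne_top hM <|
      (lintegral_mono fun θ => hbound _ (hmem z hz θ)).trans_eq (by simp)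
  · have hcircle : ∀ θ, circleMap c s θ ∈ closedBall (0 : ℂ) R := fun θ =>
      hcs (circleMap_mem_closedBall c hs.le θ)
    calc circleMean (fun ζ => u (ζ * c)) 0 1
        ≤ ∫⁻ φ, circleMean (fun z => u (circleMap 0 1 φ * z)) c s ∂angleMeasure := by
          refine lintegral_mono fun φ => ?_
          rw [circleMean_comp_mul u c s (by simp)]
          refine hu.le_circleMean _ s hs ?_
          have hrot := smul_set_mono (a := circleMap 0 1 φ) hcs
          rw [_root_.smul_closedBall _ _ hs.le,
            smul_closedBall' (circleMap_ne_center one_ne_zero)] at hrot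
          simpa using hrot
      _ = circleMean (fun z => circleMean (fun ζ => u (ζ * z)) 0 1) c s := by
          refine lintegral_lintegral_swap (Measurable.aemeasurable ?_)
          exact measurable_comp_of_upperSemicontinuousOn hu.upperSemicontinuousOn
            (g := fun q : ℝ × ℝ => circleMap 0 1 q.1 * circleMap c s q.2) (by fun_prop)
            fun q => hmem _ (hcircle q.2) q.1

/-- Let `m` be a point where the radial subharmonic function `circleMean u 0 ‖z‖` is maximal in the
disc of radius `t`. The circle of radius `t - ‖m‖` about `m` touches the circle of radius `t`, and
the function is constant on it. -/
theorem circleMean_zero_mono {s t : ℝ} (hu : IsSubharmonicOn u (closedBall 0 t)) (hs : 0 ≤ s)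
    (hst : s ≤ t) : circleMean u 0 s ≤ circleMean u 0 t := by
  have hv := hu.circleMean_zero_norm
  obtain ⟨m, hm, hmax⟩ := hv.upperSemicontinuousOn.exists_isMaxOn
    (nonempty_closedBall.2 (hs.trans hst)) (isCompact_closedBall 0 t)
  have hle : circleMean u 0 s ≤ circleMean u 0 ‖m‖ := by
    simpa [abs_of_nonneg hs] using hmax (show (s : ℂ) ∈ closedBall 0 t by simpa [abs_of_nonneg hs])
  rcases (mem_closedBall_zero_iff.1 hm).eq_or_lt with hmt | hmt
  · rwa [← hmt]
  have hball : closedBall m (t - ‖m‖) ⊆ closedBall 0 t :=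
    closedBall_subset_closedBall' (by simp)
  have htouch : ‖circleMap m (t - ‖m‖) m.arg‖ = t := by
    have : circleMap m (t - ‖m‖) m.arg = t * Complex.exp (m.arg * Complex.I) := by
      rw [circleMap, Complex.ofReal_sub]
      linear_combination -Complex.norm_mul_exp_arg_mul_I m
    simp [this, abs_of_nonneg (hs.trans hst)]
  have hconst := (hv.mono hball).eq_center_of_forall_le_center (sub_pos.2 hmt)
    (fun z hz => hmax (hball (sphere_subset_closedBall hz)))
    (circleMap m (t - ‖m‖) m.arg) (circleMap_mem_sphere m (sub_pos.2 hmt).le _)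
  rw [htouch] at hconst
  rwa [hconst]

theorem circleMean_monotoneOn (hu : IsSubharmonicOn u unitDisc) :
    MonotoneOn (circleMean u 0) (Ico 0 1) := fun _ ha _ hb hab =>
  (hu.mono (closedBall_subset_ball hb.2)).circleMean_zero_mono ha.1 hab

theorem circleMean_ne_top {c : ℂ} {R : ℝ}
    (hu : IsSubharmonicOn u (closedBall c |R|)) : circleMean u c R ≠ ∞ := by
  obtain ⟨M, hM, hbound⟩ := hu.exists_bound (isCompact_closedBall c |R|)
  refine ne_top_of_le_ne_top hM ?_
  rw [← circleMean_const M c R]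
  exact circleMean_mono fun z hz => hbound z (sphere_subset_closedBall hz)

theorem circleMean_indicator_ball_le {s t : ℝ} (hu : IsSubharmonicOn u (closedBall 0 t))
    (hs : 0 ≤ s) : circleMean ((ball 0 t).indicator u) 0 s ≤ circleMean u 0 t := by
  rcases lt_or_ge s t with hst | hst
  · exact (circleMean_mono fun z _ => indicator_le_self _ u z).trans
      (hu.circleMean_zero_mono hs hst.le)
  · refine (circleMean_mono (v := fun _ => 0) fun z hz => ?_).trans (by simp [circleMean_const])
    rw [indicator_of_notMem]
    simpa [mem_sphere_zero_iff_norm.1 hz, abs_of_nonneg hs] using hst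

end IsSubharmonicOn

section PowerOfModulus

variable {f : ℂ → ℂ} {c : ℂ} {R p : ℝ}

theorem log_norm_le_circleAverage_log_norm (hR : 0 < R)
    (hf : AnalyticOnNhd ℂ f (closedBall c R)) (hc : f c ≠ 0) :
    log ‖f c‖ ≤ circleAverage (fun z => log ‖f z‖) c R := by
  have hf' : AnalyticOnNhd ℂ f (closedBall c |R|) := by rwa [abs_of_pos hR]
  rw [AnalyticOnNhd.circleAverage_log_norm hR.ne' hf' hc]
  refine le_add_of_nonneg_left (finsum_nonneg fun z => ?_)
  by_cases hz : z ∈ closedBall c |R|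
  · refine mul_nonneg (mod_cast MeromorphicOn.AnalyticOnNhd.divisor_nonneg hf' z) ?_
    rcases eq_or_ne z c with rfl | hzc
    · simp
    refine log_nonneg ?_
    rw [abs_of_pos hR, mem_closedBall, dist_comm, dist_eq_norm] at hz
    rwa [← div_eq_mul_inv, one_le_div (norm_pos_iff.2 (sub_ne_zero.2 hzc.symm))]
  · simp [hz]

theorem exp_circleAverage_le {v : ℂ → ℝ} (hv : CircleIntegrable v c R)
    (hexp : CircleIntegrable (fun z => exp (v z)) c R) :
    exp (circleAverage v c R) ≤ circleAverage (fun z => exp (v z)) c R := by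
  simp only [circleAverage_eq_intervalAverage]
  refine convexOn_exp.map_set_average_le continuous_exp.continuousOn isClosed_univ ?_ ?_
    (by simp) (intervalIntegrable_iff.1 hv) (intervalIntegrable_iff.1 hexp)
  · simp [uIoc, two_pi_pos.le, pi_pos]
  · simp [uIoc, two_pi_pos.le, ENNReal.mul_eq_top]

theorem norm_rpow_eq_exp_mul_log_codiscreteWithin_sphere (p : ℝ) (hR : 0 < R)
    (hf : AnalyticOnNhd ℂ f (closedBall c R)) (hc : f c ≠ 0) :
    (fun z => ‖f z‖ ^ p) =ᶠ[codiscreteWithin (sphere c |R|)]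
      fun z => exp (p * log ‖f z‖) := by
  have hcmem : c ∈ closedBall c R := mem_closedBall_self hR.le
  have hne : f ⁻¹' {0}ᶜ ∈ codiscreteWithin (closedBall c R) :=
    hf.preimage_zero_mem_codiscreteWithin hc hcmem
      ⟨⟨c, hcmem⟩, (convex_closedBall c R).isPreconnected⟩
  rw [abs_of_pos hR]
  filter_upwards [codiscreteWithin_mono sphere_subset_closedBall hne] with z hz
  rw [rpow_def_of_pos (norm_pos_iff.2 hz), mul_comm]

theorem norm_rpow_le_circleAverage (hR : 0 < R) (hp : 0 < p)
    (hf : AnalyticOnNhd ℂ f (closedBall c R)) :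
    ‖f c‖ ^ p ≤ circleAverage (fun z => ‖f z‖ ^ p) c R := by
  rcases eq_or_ne (f c) 0 with hc | hc
  · rw [hc, norm_zero, zero_rpow hp.ne']
    exact circleAverage_nonneg_of_nonneg fun _ _ => by positivity
  have hsphere : AnalyticOnNhd ℂ f (sphere c |R|) := by
    rw [abs_of_pos hR]
    exact hf.mono sphere_subset_closedBall
  have hae := norm_rpow_eq_exp_mul_log_codiscreteWithin_sphere p hR hf hc
  have hlog : CircleIntegrable (fun z => p * log ‖f z‖) c R :=
    (MeromorphicOn.circleIntegrable_log_norm hsphere.meromorphicOn).const_mul p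
  have hexp : CircleIntegrable (fun z => exp (p * log ‖f z‖)) c R :=
    (circleIntegrable_congr_codiscreteWithin hae).1 <| ContinuousOn.circleIntegrable' <|
      hsphere.continuousOn.norm.rpow_const fun _ _ => Or.inr hp.le
  calc ‖f c‖ ^ p = exp (p * log ‖f c‖) := by
        rw [rpow_def_of_pos (norm_pos_iff.2 hc), mul_comm]
    _ ≤ exp (p * circleAverage (fun z => log ‖f z‖) c R) := by
        gcongr
        exact log_norm_le_circleAverage_log_norm hR hf hc
    _ = exp (circleAverage (fun z => p * log ‖f z‖) c R) :=
        congrArg exp (circleAverage_fun_smul (a := p) (f := fun z => log ‖f z‖)).symm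
    _ ≤ circleAverage (fun z => exp (p * log ‖f z‖)) c R := exp_circleAverage_le hlog hexp
    _ = circleAverage (fun z => ‖f z‖ ^ p) c R :=
        (circleAverage_congr_codiscreteWithin hae hR.ne').symm

theorem ofReal_circleAverage {v : ℂ → ℝ} (hv : ContinuousOn v (sphere c |R|))
    (hv₀ : ∀ z ∈ sphere c |R|, 0 ≤ v z) :
    ENNReal.ofReal (circleAverage v c R) = circleMean (fun z => ENNReal.ofReal (v z)) c R := by
  have hcont : Continuous fun θ => v (circleMap c R θ) :=
    hv.comp_continuous (continuous_circleMap c R) (circleMap_mem_sphere' c R)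
  have hper : Function.Periodic (fun θ => v (circleMap c R θ)) (2 * π) :=
    fun θ => by simp only [periodic_circleMap c R θ]
  have hint : ∫ θ in Ioo (-π) π, v (circleMap c R θ) = ∫ θ in (0)..2 * π, v (circleMap c R θ) := by
    rw [← integral_Ioc_eq_integral_Ioo, ← intervalIntegral.integral_of_le (by linarith [pi_pos])]
    have := hper.intervalIntegral_add_eq (-π) 0
    rwa [neg_add_eq_sub, two_mul, add_sub_cancel_right, zero_add, ← two_mul] at this
  rw [circleMean, angleMeasure_eq_smul, lintegral_smul_measure, smul_eq_mul,
    ← ofReal_integral_eq_lintegral_ofReal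
      ((hcont.integrableOn_Icc (a := -π) (b := π)).mono_set Ioo_subset_Icc_self)
      (ae_of_all _ fun θ => hv₀ _ (circleMap_mem_sphere' c R θ)),
    hint, ← ENNReal.ofReal_inv_of_pos two_pi_pos, ← ENNReal.ofReal_mul (by positivity),
    circleAverage_def, smul_eq_mul]

theorem isSubharmonicOn_enorm_rpow {U : Set ℂ} (hU : IsOpen U) (hf : DifferentiableOn ℂ f U)
    (hp : 0 < p) : IsSubharmonicOn (fun z => ‖f z‖ₑ ^ p) U where
  upperSemicontinuousOn := (ENNReal.continuous_rpow_const.comp_continuousOn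
    hf.continuousOn.enorm).upperSemicontinuousOn
  ne_top _ _ := ENNReal.rpow_ne_top_of_nonneg hp.le enorm_ne_top
  le_circleMean c R hR hcR := by
    have hfR : AnalyticOnNhd ℂ f (closedBall c R) := (hf.analyticOnNhd hU).mono hcR
    have hcont : ContinuousOn (fun z => ‖f z‖ ^ p) (sphere c |R|) := by
      rw [abs_of_pos hR]
      exact (hfR.continuousOn.mono sphere_subset_closedBall).norm.rpow_const
        fun _ _ => Or.inr hp.le
    have hofReal : ∀ z, ‖f z‖ₑ ^ p = ENNReal.ofReal (‖f z‖ ^ p) := fun z => by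
      rw [← ofReal_norm, ENNReal.ofReal_rpow_of_nonneg (norm_nonneg _) hp.le]
    simp only [hofReal]
    rw [← ofReal_circleAverage hcont fun z _ => by positivity]
    exact ENNReal.ofReal_le_ofReal (norm_rpow_le_circleAverage hR hp hfR)

theorem MemBergman.isSubharmonicOn {ω : ℂ → ℝ} (hf : MemBergman p ω f) (hp : 0 < p) :
    IsSubharmonicOn (fun z => ‖f z‖ₑ ^ p) unitDisc :=
  isSubharmonicOn_enorm_rpow isOpen_ball hf.analytic hp

end PowerOfModulus

section PseudohyperbolicGeometry

open scoped ComplexConjugate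

variable {z ζ : ℂ} {r : ℝ}

theorem norm_sub_lt_of_mem_pseudoDisc (hz : z ∈ unitDisc) (hζ : ζ ∈ pseudoDisc z r) :
    ‖z - ζ‖ < r * ‖1 - conj z * ζ‖ := by
  have hlt : ‖conj z * ζ‖ < 1 := by
    rw [norm_mul, Complex.norm_conj]
    exact mul_lt_one_of_nonneg_of_lt_one_left (norm_nonneg z) (mem_ball_zero_iff.1 hz)
      (mem_ball_zero_iff.1 hζ.1).le
  have hpos : 0 < ‖1 - conj z * ζ‖ := by
    refine norm_pos_iff.2 (sub_ne_zero.2 fun h => ?_)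
    simp [← h] at hlt
  rw [← div_lt_iff₀ hpos, ← norm_div]
  exact hζ.2

theorem norm_one_sub_conj_mul_le (hz : z ∈ unitDisc) :
    ‖1 - conj z * ζ‖ ≤ 2 * (1 - ‖z‖) + ‖z - ζ‖ := by
  have hz1 : ‖z‖ < 1 := mem_ball_zero_iff.1 hz
  have hsplit : 1 - conj z * ζ = ((1 - ‖z‖ ^ 2 : ℝ) : ℂ) + conj z * (z - ζ) := by
    push_cast
    rw [← Complex.conj_mul']
    ring
  calc ‖1 - conj z * ζ‖ ≤ (1 - ‖z‖ ^ 2) + ‖z‖ * ‖z - ζ‖ := by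
        rw [hsplit]
        refine (norm_add_le _ _).trans_eq ?_
        rw [norm_mul, Complex.norm_conj, Complex.norm_real, norm_of_nonneg]
        nlinarith [norm_nonneg z]
    _ ≤ 2 * (1 - ‖z‖) + ‖z - ζ‖ := by nlinarith [norm_nonneg z, norm_nonneg (z - ζ)]

theorem mem_pseudoDisc_symm (hz : z ∈ unitDisc) (hζ : ζ ∈ pseudoDisc z r) :
    z ∈ pseudoDisc ζ r := by
  refine ⟨hz, ?_⟩
  have hconj : conj (1 - conj z * ζ) = 1 - conj ζ * z := by simp [mul_comm]
  rw [norm_div, norm_sub_rev, ← hconj, Complex.norm_conj, ← norm_div]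
  exact hζ.2

theorem norm_sub_le_of_mem_pseudoDisc (hr : r < 1) (hz : z ∈ unitDisc)
    (hζ : ζ ∈ pseudoDisc z r) : ‖z - ζ‖ ≤ 2 * r / (1 - r) * (1 - ‖z‖) := by
  have hr0 : 0 ≤ r := (norm_nonneg _).trans hζ.2.le
  rw [div_mul_eq_mul_div, le_div_iff₀ (sub_pos.2 hr)]
  nlinarith [norm_sub_lt_of_mem_pseudoDisc hz hζ, norm_one_sub_conj_mul_le (ζ := ζ) hz]

theorem one_sub_norm_le_of_mem_pseudoDisc (hr : r < 1) (hz : z ∈ unitDisc)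
    (hζ : ζ ∈ pseudoDisc z r) : (1 - r) * (1 - ‖z‖) ≤ (1 + r) * (1 - ‖ζ‖) := by
  have hdist := norm_sub_le_of_mem_pseudoDisc hr hζ.1 (mem_pseudoDisc_symm hz hζ)
  rw [div_mul_eq_mul_div, le_div_iff₀ (sub_pos.2 hr)] at hdist
  have htri : ‖ζ‖ - ‖z‖ ≤ ‖ζ - z‖ := norm_sub_norm_le ζ z
  nlinarith

theorem ball_subset_of_mem_pseudoDisc {κ : ℝ} (hr : r < 1) (hκ : 2 * κ * (1 + r) ≤ 1 - r)
    (hz : z ∈ unitDisc) (hζ : ζ ∈ pseudoDisc z r) :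
    ball ζ (κ * (1 - ‖z‖)) ⊆
      ball z ((2 * r / (1 - r) + κ) * (1 - ‖z‖)) ∩ ball 0 (1 - κ * (1 - ‖z‖)) := by
  have hz1 : ‖z‖ < 1 := mem_ball_zero_iff.1 hz
  have hr0 : 0 ≤ r := (norm_nonneg _).trans hζ.2.le
  refine subset_inter (ball_subset_ball' ?_) (ball_subset_ball' ?_)
  · rw [dist_comm, dist_eq_norm]
    linarith [norm_sub_le_of_mem_pseudoDisc hr hz hζ]
  · have hκζ : 2 * κ * (1 - ‖z‖) ≤ 1 - ‖ζ‖ := by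
      refine le_of_mul_le_mul_left ?_ (show 0 < 1 + r by linarith)
      nlinarith [one_sub_norm_le_of_mem_pseudoDisc hr hz hζ]
    rw [dist_zero_right]
    linarith

end PseudohyperbolicGeometry

/-- The pseudohyperbolic maximal function of `u`: its supremum over `Δ(z, r)`. -/
noncomputable def pseudoSup (r : ℝ) (u : ℂ → ℝ≥0∞) (z : ℂ) : ℝ≥0∞ :=
  ⨆ ζ ∈ pseudoDisc z r, u ζ

section PseudoSup

variable {r κ s : ℝ} {u : ℂ → ℝ≥0∞}

theorem volume_ball_mul_pseudoSup_le (hr : r < 1) (hκ : 0 < κ) (hκr : 2 * κ * (1 + r) ≤ 1 - r)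
    (hu : IsSubharmonicOn u unitDisc) {z : ℂ} (hz : z ∈ unitDisc) :
    volume (ball (0 : ℂ) (κ * (1 - ‖z‖))) * pseudoSup r u z ≤
      ∫⁻ w in ball z ((2 * r / (1 - r) + κ) * (1 - ‖z‖)) ∩ ball 0 (1 - κ * (1 - ‖z‖)), u w := by
  have hz1 : 0 < 1 - ‖z‖ := sub_pos.2 (mem_ball_zero_iff.1 hz)
  simp only [pseudoSup, ENNReal.mul_iSup]
  refine iSup₂_le fun ζ hζ => ?_
  have hsub := ball_subset_of_mem_pseudoDisc hr hκr hz hζ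
  have hdisc : ball ζ (κ * (1 - ‖z‖)) ⊆ unitDisc :=
    hsub.trans (inter_subset_right.trans (ball_subset_ball (by nlinarith)))
  rw [Complex.volume_ball, ← Complex.volume_ball ζ]
  exact (hu.mono hdisc).volume_ball_mul_le.trans (lintegral_mono_set hsub)

theorem setLIntegral_ball_mul {a : ℂ} (ha : ‖a‖ = 1) (g : ℂ → ℝ≥0∞) (c : ℂ) (R : ℝ) :
    ∫⁻ w in ball (a * c) R, g w = ∫⁻ w in ball c R, g (a * w) := by
  let rot : ℂ ≃ₗᵢ[ℝ] ℂ := rotation ⟨a, mem_sphere_zero_iff_norm.2 ha⟩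
  have hrot : ∀ w, rot w = a * w := fun w => rfl
  rw [← rot.measurePreserving.setLIntegral_comp_preimage_emb
    rot.toHomeomorph.measurableEmbedding, ← hrot, rot.preimage_ball, rot.symm_apply_apply]
  rfl

theorem circleMean_setLIntegral_ball {g : ℂ → ℝ≥0∞} (hg : Measurable g) (R : ℝ) :
    circleMean (fun z => ∫⁻ w in ball z R, g w) 0 s =
      ∫⁻ w in ball (s : ℂ) R, circleMean g 0 ‖w‖ := by
  have hrotate : ∀ θ, ∫⁻ w in ball (circleMap 0 s θ) R, g w =
      ∫⁻ w in ball (s : ℂ) R, g (circleMap 0 1 θ * w) := by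
    intro θ
    rw [← setLIntegral_ball_mul (by simp)]
    simp [circleMap, mul_comm]
  simp only [circleMean_zero_norm_eq]
  simp only [circleMean, hrotate]
  exact lintegral_lintegral_swap (by fun_prop)

theorem circleMean_pseudoSup_le (hr : r < 1) (hκ : 0 < κ) (hκr : 2 * κ * (1 + r) ≤ 1 - r)
    (hu : IsSubharmonicOn u unitDisc) (hs : s ∈ Ioo 0 1) :
    circleMean (pseudoSup r u) 0 s ≤
      ENNReal.ofReal ((2 * r / (1 - r) + κ) / κ) ^ 2 * circleMean u 0 (1 - κ * (1 - s)) := by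
  set ρ := 1 - κ * (1 - s) with hρ_def
  set K := 2 * r / (1 - r) + κ with hK_def
  have hκs : 0 < κ * (1 - s) := mul_pos hκ (sub_pos.2 hs.2)
  have hρ : closedBall 0 ρ ⊆ unitDisc := closedBall_subset_ball (by linarith)
  have hvol : volume (ball (0 : ℂ) (κ * (1 - s))) * circleMean (pseudoSup r u) 0 s ≤
      volume (ball (0 : ℂ) (K * (1 - s))) * circleMean u 0 ρ := by
    calc volume (ball (0 : ℂ) (κ * (1 - s))) * circleMean (pseudoSup r u) 0 s
        = circleMean (fun z => volume (ball (0 : ℂ) (κ * (1 - s))) * pseudoSup r u z) 0 s :=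
          (lintegral_const_mul' _ _ measure_ball_lt_top.ne).symm
      _ ≤ circleMean (fun z => ∫⁻ w in ball z (K * (1 - s)), (ball 0 ρ).indicator u w) 0 s := by
          refine circleMean_mono fun z hz => ?_
          have hzs : ‖z‖ = s := by rw [mem_sphere_zero_iff_norm.1 hz, abs_of_pos hs.1]
          rw [setLIntegral_indicator measurableSet_ball, inter_comm, hρ_def, hK_def, ← hzs]
          exact volume_ball_mul_pseudoSup_le hr hκ hκr hu (mem_ball_zero_iff.2 (hzs.trans_lt hs.2))
      _ = ∫⁻ w in ball (s : ℂ) (K * (1 - s)), circleMean ((ball 0 ρ).indicator u) 0 ‖w‖ :=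
          circleMean_setLIntegral_ball
            ((hu.mono (ball_subset_closedBall.trans hρ)).measurable_indicator measurableSet_ball) _
      _ ≤ ∫⁻ _ in ball (s : ℂ) (K * (1 - s)), circleMean u 0 ρ :=
          lintegral_mono fun w => (hu.mono hρ).circleMean_indicator_ball_le (norm_nonneg w)
      _ = volume (ball (0 : ℂ) (K * (1 - s))) * circleMean u 0 ρ := by
          rw [setLIntegral_const, mul_comm, Complex.volume_ball, Complex.volume_ball]
  have hscale : volume (ball (0 : ℂ) (K * (1 - s))) =
      volume (ball (0 : ℂ) (κ * (1 - s))) * ENNReal.ofReal (K / κ) ^ 2 := by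
    have hK : K * (1 - s) = K / κ * (κ * (1 - s)) := by field_simp
    rw [Complex.volume_ball, Complex.volume_ball, hK, ENNReal.ofReal_mul' hκs.le]
    ring
  rw [hscale, mul_assoc] at hvol
  exact (ENNReal.mul_le_mul_iff_right (measure_ball_pos volume 0 hκs).ne'
    measure_ball_lt_top.ne).1 hvol

end PseudoSup

section LayerCake

variable {α β : Type*} [MeasurableSpace α] [MeasurableSpace β] {μ : Measure α} {ν : Measure β}
  {f : α → ℝ≥0∞} {g : β → ℝ≥0∞}

theorem lintegral_eq_lintegral_measure_ofReal_lt (hf : AEMeasurable f μ)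
    (hf_top : ∀ᵐ a ∂μ, f a ≠ ∞) :
    ∫⁻ a, f a ∂μ = ∫⁻ t in Ioi (0 : ℝ), μ {a | ENNReal.ofReal t < f a} := by
  calc ∫⁻ a, f a ∂μ = ∫⁻ a, ENNReal.ofReal (f a).toReal ∂μ :=
        lintegral_congr_ae <| hf_top.mono fun a ha => (ENNReal.ofReal_toReal ha).symm
    _ = ∫⁻ t in Ioi (0 : ℝ), μ {a | t < (f a).toReal} :=
        lintegral_eq_lintegral_meas_lt μ (ae_of_all _ fun _ => ENNReal.toReal_nonneg)
          hf.ennreal_toReal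
    _ = ∫⁻ t in Ioi (0 : ℝ), μ {a | ENNReal.ofReal t < f a} := by
        refine setLIntegral_congr_fun measurableSet_Ioi fun t ht => measure_congr ?_
        filter_upwards [hf_top] with a ha
        exact propext (ENNReal.ofReal_lt_iff_lt_toReal (mem_Ioi.1 ht).le ha).symm

theorem lintegral_le_of_measure_lt_le {C : ℝ≥0∞} (hf : AEMeasurable f μ) (hg : AEMeasurable g ν)
    (hf_top : ∀ᵐ a ∂μ, f a ≠ ∞) (hg_top : ∀ᵐ b ∂ν, g b ≠ ∞)
    (h : ∀ l, μ {a | l < f a} ≤ C * ν {b | l < g b}) : ∫⁻ a, f a ∂μ ≤ C * ∫⁻ b, g b ∂ν := by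
  have hanti : Antitone fun t : ℝ => ν {b | ENNReal.ofReal t < g b} := fun s t hst =>
    measure_mono fun b hb => (ENNReal.ofReal_le_ofReal hst).trans_lt hb
  rw [lintegral_eq_lintegral_measure_ofReal_lt hf hf_top,
    lintegral_eq_lintegral_measure_ofReal_lt hg hg_top, ← lintegral_const_mul _ hanti.measurable]
  exact lintegral_mono fun t => h _

end LayerCake

/-- The tail `t ↦ μ (t, 1)` of a measure on the radii is doubling with constant `C`. -/
def HasDoublingTail (μ : Measure ℝ) (C : ℝ≥0∞) : Prop :=
  ∀ t, 0 ≤ t → t < 1 → μ (Ioo t 1) ≤ C * μ (Ioo ((1 + t) / 2) 1)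

namespace HasDoublingTail

variable {μ : Measure ℝ} [NullSingletonClass μ] {C : ℝ≥0∞} {V : ℝ → ℝ≥0∞}

theorem measure_preimage_halfway_le (hμ : HasDoublingTail μ C) {B : Set ℝ}
    (hB : ∀ a ∈ B, Ico a 1 ⊆ B) :
    μ ((fun s => (1 + s) / 2) ⁻¹' B ∩ Ioo 0 1) ≤ C * μ (B ∩ Ioo 0 1) := by
  set A := (fun s : ℝ => (1 + s) / 2) ⁻¹' B ∩ Ioo 0 1
  rcases A.eq_empty_or_nonempty with hA | ⟨a, ha⟩
  · simp [hA]
  have hbdd : BddBelow A := ⟨0, fun s hs => hs.2.1.le⟩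
  have ht0 : 0 ≤ sInf A := le_csInf ⟨a, ha⟩ fun s hs => hs.2.1.le
  have ht1 : sInf A < 1 := (csInf_le hbdd ha).trans_lt ha.2.2
  have hAt : A ⊆ Ico (sInf A) 1 := fun s hs => ⟨csInf_le hbdd hs, hs.2.2⟩
  have htB : Ioo ((1 + sInf A) / 2) 1 ⊆ B ∩ Ioo 0 1 := by
    intro s hs
    obtain ⟨b, hb, hbs⟩ := exists_lt_of_csInf_lt ⟨a, ha⟩
      (show sInf A < 2 * s - 1 by linarith [hs.1])
    exact ⟨hB _ hb.1 ⟨by linarith, hs.2⟩, by linarith [hs.1], hs.2⟩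
  calc μ A ≤ μ (Ioo (sInf A) 1) := (measure_mono hAt).trans_eq Ioo_ae_eq_Ico.symm.measure_eq
    _ ≤ C * μ (Ioo ((1 + sInf A) / 2) 1) := hμ _ ht0 ht1
    _ ≤ C * μ (B ∩ Ioo 0 1) := by gcongr

theorem lintegral_comp_halfway_le (hμ : HasDoublingTail μ C) (hV : MonotoneOn V (Ico 0 1))
    (hV_top : ∀ s ∈ Ico 0 1, V s ≠ ∞) :
    ∫⁻ s in Ioo 0 1, V ((1 + s) / 2) ∂μ ≤ C * ∫⁻ s in Ioo 0 1, V s ∂μ := by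
  have hhalf : ∀ s ∈ Ioo (0 : ℝ) 1, (1 + s) / 2 ∈ Ico 0 1 := fun s hs =>
    ⟨by linarith [hs.1], by linarith [hs.2]⟩
  refine lintegral_le_of_measure_lt_le
    (aemeasurable_restrict_of_monotoneOn measurableSet_Ioo fun a ha b hb hab =>
      hV (hhalf a ha) (hhalf b hb) (by linarith))
    (aemeasurable_restrict_of_monotoneOn measurableSet_Ioo (hV.mono Ioo_subset_Ico_self))
    ((ae_restrict_mem measurableSet_Ioo).mono fun s hs => hV_top _ (hhalf s hs))
    ((ae_restrict_mem measurableSet_Ioo).mono fun s hs => hV_top s (Ioo_subset_Ico_self hs))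
    fun l => ?_
  rw [Measure.restrict_apply' measurableSet_Ioo, Measure.restrict_apply' measurableSet_Ioo]
  calc μ ({s | l < V ((1 + s) / 2)} ∩ Ioo 0 1)
      ≤ μ ((fun s => (1 + s) / 2) ⁻¹' {s ∈ Ico 0 1 | l < V s} ∩ Ioo 0 1) :=
        measure_mono fun s hs => ⟨⟨hhalf s hs.2, hs.1⟩, hs.2⟩
    _ ≤ C * μ ({s ∈ Ico 0 1 | l < V s} ∩ Ioo 0 1) :=
        hμ.measure_preimage_halfway_le fun a ha s hs =>
          have hs01 : s ∈ Ico (0 : ℝ) 1 := ⟨ha.1.1.trans hs.1, hs.2⟩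
          ⟨hs01, ha.2.trans_le (hV ha.1 hs01 hs.1)⟩
    _ ≤ C * μ ({s | l < V s} ∩ Ioo 0 1) := by
        gcongr
        exact fun hs => hs.2

theorem lintegral_comp_halfway_iterate_le (hμ : HasDoublingTail μ C) (hV : MonotoneOn V (Ico 0 1))
    (hV_top : ∀ s ∈ Ico 0 1, V s ≠ ∞) (n : ℕ) :
    ∫⁻ s in Ioo 0 1, V (1 - (1 / 2) ^ n * (1 - s)) ∂μ ≤ C ^ n * ∫⁻ s in Ioo 0 1, V s ∂μ := by
  induction n with
  | zero => simp
  | succ n ih =>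
    have hpos : (0 : ℝ) < (1 / 2) ^ n := by positivity
    have hle : (1 / 2 : ℝ) ^ n ≤ 1 := pow_le_one₀ (by norm_num) (by norm_num)
    have hmaps : ∀ s ∈ Ico (0 : ℝ) 1, 1 - (1 / 2) ^ n * (1 - s) ∈ Ico (0 : ℝ) 1 := fun s hs =>
      ⟨by nlinarith [hs.1, hs.2], by nlinarith [hs.1, hs.2]⟩
    have hsucc : ∀ s : ℝ, 1 - (1 / 2) ^ (n + 1) * (1 - s) = 1 - (1 / 2) ^ n * (1 - (1 + s) / 2) :=
      fun s => by ring
    simp_rw [hsucc]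
    refine (hμ.lintegral_comp_halfway_le (V := fun s => V (1 - (1 / 2) ^ n * (1 - s)))
      (fun a ha b hb hab => hV (hmaps a ha) (hmaps b hb) (by nlinarith))
      fun s hs => hV_top _ (hmaps s hs)).trans ?_
    rw [pow_succ', mul_assoc]
    gcongr

end HasDoublingTail

section RadialWeight

variable {ω : ℂ → ℝ} {V : ℝ → ℝ≥0∞} {s t : ℝ}

theorem IsWeight.aemeasurable (hω : IsWeight ω) : AEMeasurable ω (volume.restrict unitDisc) :=
  hω.integrable.aestronglyMeasurable.aemeasurable.mono_ac <|
    Measure.absolutelyContinuous_smul (by simp [pi_pos])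

theorem IsRadial.eq_circleMap (hω : IsRadial ω) (hs : s ∈ Ioo 0 1) (θ : ℝ) :
    ω (circleMap 0 s θ) = ω s := by
  have hnorm : ‖circleMap 0 s θ‖ = s := by rw [norm_circleMap_zero, abs_of_pos hs.1]
  rw [hω _ (mem_ball_zero_iff.2 (hnorm.trans_lt hs.2)), hnorm]

theorem IsRadial.aemeasurable_radius (hω : IsRadial ω)
    (hm : AEMeasurable ω (volume.restrict unitDisc)) :
    AEMeasurable (fun s : ℝ => ω s) (volume.restrict (Ioo 0 1)) := by
  obtain ⟨g, hgm, hg⟩ := hm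
  have hswap := Measure.ae_ae_of_ae_prod <|
    Measure.measurePreserving_swap.quasiMeasurePreserving.ae <|
      (quasiMeasurePreserving_circleMap 0 1).ae hg
  obtain ⟨θ, hθ⟩ := hswap.exists
  refine ⟨fun s => g (circleMap 0 s θ), hgm.comp (by unfold circleMap; fun_prop), ?_⟩
  filter_upwards [hθ, ae_restrict_mem measurableSet_Ioo] with s hs hs01
  rw [← hω.eq_circleMap hs01 θ]
  exact hs

theorem IsRadial.circleMean_mul (hω : IsRadial ω) (hs : s ∈ Ioo 0 1) (u : ℂ → ℝ≥0∞) :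
    circleMean (fun z => u z * ENNReal.ofReal (ω z)) 0 s =
      circleMean u 0 s * ENNReal.ofReal (ω s) := by
  simp only [circleMean, hω.eq_circleMap hs]
  exact lintegral_mul_const' _ _ ENNReal.ofReal_ne_top

/-- The image of the measure `ω dx dy / 2π` on the unit disc under `z ↦ ‖z‖`, for radial `ω`. -/
noncomputable def radialMeasure (ω : ℂ → ℝ) : Measure ℝ :=
  (volume.restrict (Ioo 0 1)).withDensity fun s => ENNReal.ofReal s * ENNReal.ofReal (ω s)

instance : NullSingletonClass (radialMeasure ω) := by
  unfold radialMeasure; infer_instance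

theorem radialMeasure_Ioo (ht : 0 ≤ t) : radialMeasure ω (Ioo t 1) =
    ∫⁻ s in Ioo t 1, ENNReal.ofReal s * ENNReal.ofReal (ω s) := by
  rw [radialMeasure, withDensity_apply _ measurableSet_Ioo,
    Measure.restrict_restrict measurableSet_Ioo, inter_eq_left.2 (Ioo_subset_Ioo_left ht)]

theorem MemDHat.exists_hasDoublingTail (hω : MemDHat ω) :
    ∃ C : ℝ, 0 < C ∧ HasDoublingTail (radialMeasure ω) (ENNReal.ofReal C) := by
  obtain ⟨C, hC1, hC⟩ := hω.doubling
  refine ⟨C * 2, by linarith, fun t ht0 ht1 => ?_⟩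
  rw [radialMeasure_Ioo ht0, radialMeasure_Ioo (by linarith)]
  calc ∫⁻ s in Ioo t 1, ENNReal.ofReal s * ENNReal.ofReal (ω s)
      ≤ tail ω t := by
        refine setLIntegral_mono' measurableSet_Ioo fun s hs => ?_
        exact mul_le_of_le_one_left' (ENNReal.ofReal_le_one.2 hs.2.le)
    _ ≤ ENNReal.ofReal C * tail ω ((1 + t) / 2) := hC t ht0 ht1
    _ ≤ ENNReal.ofReal C * (ENNReal.ofReal 2 *
          ∫⁻ s in Ioo ((1 + t) / 2) 1, ENNReal.ofReal s * ENNReal.ofReal (ω s)) := by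
        gcongr
        rw [← lintegral_const_mul' _ _ ENNReal.ofReal_ne_top]
        refine setLIntegral_mono' measurableSet_Ioo fun s hs => ?_
        rw [← mul_assoc, ← ENNReal.ofReal_mul zero_le_two]
        exact le_mul_of_one_le_left' (ENNReal.one_le_ofReal.2 (by linarith [hs.1]))
    _ = _ := by rw [← mul_assoc, ENNReal.ofReal_mul (by linarith)]

theorem IsRadial.setLIntegral_radialMeasure (hω : IsRadial ω)
    (hm : AEMeasurable ω (volume.restrict unitDisc)) (hV : MonotoneOn V (Ico 0 1)) :
    ∫⁻ s in Ioo 0 1, V s ∂radialMeasure ω =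
      ∫⁻ s in Ioo 0 1, ENNReal.ofReal s * (V s * ENNReal.ofReal (ω s)) := by
  rw [radialMeasure, restrict_withDensity measurableSet_Ioo,
    Measure.restrict_restrict measurableSet_Ioo, inter_self,
    lintegral_withDensity_eq_lintegral_mul₀]
  · refine lintegral_congr fun s => ?_
    simp only [Pi.mul_apply]
    ring
  · exact (by fun_prop : AEMeasurable _ _).mul (hω.aemeasurable_radius hm).ennreal_ofReal
  · exact aemeasurable_restrict_of_monotoneOn measurableSet_Ioo (hV.mono Ioo_subset_Ico_self)

end RadialWeight

section MaximalBound

variable {ω : ℂ → ℝ} {u : ℂ → ℝ≥0∞} {r κ : ℝ}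

theorem IsSubharmonicOn.setLIntegral_mul_weight (hu : IsSubharmonicOn u unitDisc)
    (hω : IsRadial ω) (hm : AEMeasurable ω (volume.restrict unitDisc)) :
    ∫⁻ z in unitDisc, u z * ENNReal.ofReal (ω z) =
      ENNReal.ofReal (2 * π) * ∫⁻ s in Ioo 0 1, circleMean u 0 s ∂radialMeasure ω := by
  rw [hω.setLIntegral_radialMeasure hm hu.circleMean_monotoneOn, unitDisc,
    setLIntegral_ball_eq_circleMean (g := fun z => u z * ENNReal.ofReal (ω z))
      ((hu.aemeasurable measurableSet_ball volume).mul hm.ennreal_ofReal)]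
  congr 1
  exact setLIntegral_congr_fun measurableSet_Ioo fun s hs => by rw [hω.circleMean_mul hs]

theorem setLIntegral_pseudoSup_mul_weight_le (hr₀ : 0 ≤ r) (hr₁ : r < 1) (hκ : 0 < κ)
    (hκr : 2 * κ * (1 + r) ≤ 1 - r) (hω : IsRadial ω)
    (hm : AEMeasurable ω (volume.restrict unitDisc)) (hu : IsSubharmonicOn u unitDisc) :
    ∫⁻ z in unitDisc, pseudoSup r u z * ENNReal.ofReal (ω z) ≤
      ENNReal.ofReal ((2 * r / (1 - r) + κ) / κ) ^ 2 * (ENNReal.ofReal (2 * π) *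
        ∫⁻ s in Ioo 0 1, circleMean u 0 (1 - κ * (1 - s)) ∂radialMeasure ω) := by
  set K := ENNReal.ofReal ((2 * r / (1 - r) + κ) / κ) ^ 2
  have hmono : MonotoneOn (fun s => circleMean u 0 (1 - κ * (1 - s))) (Ico 0 1) := by
    have hmaps : ∀ s ∈ Ico (0 : ℝ) 1, 1 - κ * (1 - s) ∈ Ico (0 : ℝ) 1 := fun s hs =>
      ⟨by nlinarith [hs.1, hs.2], by nlinarith [hs.2]⟩
    exact fun a ha b hb hab => hu.circleMean_monotoneOn (hmaps a ha) (hmaps b hb) (by nlinarith)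
  rw [hω.setLIntegral_radialMeasure hm hmono, mul_left_comm,
    ← lintegral_const_mul' _ _ (ENNReal.pow_ne_top ENNReal.ofReal_ne_top)]
  refine (setLIntegral_ball_le_circleMean _ 0 1).trans ?_
  refine mul_le_mul_right (setLIntegral_mono' measurableSet_Ioo fun s hs => ?_) _
  calc ENNReal.ofReal s * circleMean (fun z => pseudoSup r u z * ENNReal.ofReal (ω z)) 0 s
      = ENNReal.ofReal s * (circleMean (pseudoSup r u) 0 s * ENNReal.ofReal (ω s)) := by
        rw [hω.circleMean_mul hs]
    _ ≤ ENNReal.ofReal s * (K * circleMean u 0 (1 - κ * (1 - s)) * ENNReal.ofReal (ω s)) := by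
        gcongr
        exact circleMean_pseudoSup_le hr₁ hκ hκr hu hs
    _ = K * (ENNReal.ofReal s * (circleMean u 0 (1 - κ * (1 - s)) * ENNReal.ofReal (ω s))) := by
        ring

theorem MemDHat.exists_setLIntegral_pseudoSup_le (hω : MemDHat ω) (hr₀ : 0 < r) (hr₁ : r < 1) :
    ∃ C : ℝ, 0 < C ∧ ∀ u, IsSubharmonicOn u unitDisc →
      ∫⁻ z in unitDisc, pseudoSup r u z * ENNReal.ofReal (ω z) ≤
        ENNReal.ofReal C * ∫⁻ z in unitDisc, u z * ENNReal.ofReal (ω z) := by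
  obtain ⟨D, hD0, hD⟩ := hω.exists_hasDoublingTail
  have hm := hω.isWeight.aemeasurable
  have hr : 0 < (1 - r) / (2 * (1 + r)) := div_pos (by linarith) (by linarith)
  obtain ⟨n, hn⟩ := exists_pow_lt_of_lt_one hr (show (1 / 2 : ℝ) < 1 by norm_num)
  rw [lt_div_iff₀ (by linarith)] at hn
  set K := (2 * r / (1 - r) + (1 / 2) ^ n) / (1 / 2) ^ n
  have hK0 : 0 < K := by
    have : 0 < 1 - r := sub_pos.2 hr₁
    positivity
  refine ⟨K ^ 2 * D ^ n, by positivity, fun u hu => ?_⟩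
  calc ∫⁻ z in unitDisc, pseudoSup r u z * ENNReal.ofReal (ω z)
      ≤ ENNReal.ofReal K ^ 2 * (ENNReal.ofReal (2 * π) *
          ∫⁻ s in Ioo 0 1, circleMean u 0 (1 - (1 / 2) ^ n * (1 - s)) ∂radialMeasure ω) :=
        setLIntegral_pseudoSup_mul_weight_le hr₀.le hr₁ (by positivity) (by linarith)
          hω.isRadial hm hu
    _ ≤ ENNReal.ofReal K ^ 2 * (ENNReal.ofReal (2 * π) *
          (ENNReal.ofReal D ^ n * ∫⁻ s in Ioo 0 1, circleMean u 0 s ∂radialMeasure ω)) := by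
        gcongr
        refine hD.lintegral_comp_halfway_iterate_le hu.circleMean_monotoneOn (fun s hs => ?_) n
        refine (hu.mono ?_).circleMean_ne_top
        rw [abs_of_nonneg hs.1]
        exact closedBall_subset_ball hs.2
    _ = ENNReal.ofReal (K ^ 2 * D ^ n) * ∫⁻ z in unitDisc, u z * ENNReal.ofReal (ω z) := by
        rw [hu.setLIntegral_mul_weight hω.isRadial hm, ENNReal.ofReal_mul (sq_nonneg K),
          ENNReal.ofReal_pow hK0.le, ENNReal.ofReal_pow hD0.le]
        ring

end MaximalBound

section Average

variable {r : ℝ} {ν : Measure ℂ} {S : ℂ → Set ℂ} {u : ℂ → ℝ≥0∞}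

/-- The set of the points `z` of the disc at which `u` is at most `ε` times its `ν`-average over
`S z`: the set `E` of the theorem, for a function `u` in place of `|f| ^ p`. -/
def subaverageSet (ν : Measure ℂ) (S : ℂ → Set ℂ) (ε : ℝ≥0) (u : ℂ → ℝ≥0∞) : Set ℂ :=
  {z ∈ unitDisc | u z ≤ ε * ⨍⁻ ζ in S z, u ζ ∂ν}

theorem badSet_eq_subaverageSet (p : ℝ) (ν : Measure ℂ) (S : ℂ → Set ℂ) (ε : ℝ) (f : ℂ → ℂ) :
    badSet p ν S ε f = subaverageSet ν S ε.toNNReal fun z => ‖f z‖ₑ ^ p := by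
  simp only [badSet, average, subaverageSet, setLAverage_eq, ENNReal.div_eq_inv_mul,
    ENNReal.ofReal]

theorem setLAverage_le_of_forall_le {α : Type*} [MeasurableSpace α] {μ : Measure α} {s : Set α}
    {g : α → ℝ≥0∞} {M : ℝ≥0∞} (hs : NullMeasurableSet s μ) (h : ∀ x ∈ s, g x ≤ M) :
    ⨍⁻ x in s, g x ∂μ ≤ M := by
  rw [setLAverage_eq]
  refine ENNReal.div_le_of_le_mul ?_
  rw [← setLIntegral_const]
  exact lintegral_mono_ae ((ae_restrict_mem₀ hs).mono h)

theorem IsAveragingFamily.setLAverage_le_pseudoSup (hS : IsAveragingFamily r ν S) {z : ℂ}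
    (hz : z ∈ unitDisc) : ⨍⁻ ζ in S z, u ζ ∂ν ≤ pseudoSup r u z :=
  setLAverage_le_of_forall_le (hS.measurable z hz) fun _ hζ =>
    le_iSup₂_of_le _ (hS.subset z hz hζ) le_rfl

theorem IsAveragingFamily.setLIntegral_subaverageSet_le (hS : IsAveragingFamily r ν S)
    {ε : ℝ≥0} {μ : Measure ℂ} (hE : NullMeasurableSet (subaverageSet ν S ε u) μ)
    (w : ℂ → ℝ≥0∞) :
    ∫⁻ z in subaverageSet ν S ε u, u z * w z ∂μ ≤
      ε * ∫⁻ z in unitDisc, pseudoSup r u z * w z ∂μ := by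
  rw [← lintegral_const_mul' _ _ ENNReal.coe_ne_top]
  refine (lintegral_mono_ae ?_).trans (lintegral_mono_set fun z hz => hz.1)
  filter_upwards [ae_restrict_mem₀ hE] with z hz
  rw [← mul_assoc]
  gcongr
  exact hz.2.trans (by gcongr; exact hS.setLAverage_le_pseudoSup hz.1)

theorem one_sub_mul_setLIntegral_le_setLIntegral_sdiff {α : Type*} [MeasurableSpace α]
    {μ : Measure α} {A B : Set α} {g : α → ℝ≥0∞} {c : ℝ≥0∞} (hfin : ∫⁻ x in A, g x ∂μ ≠ ∞)
    (hB : ∫⁻ x in B, g x ∂μ ≤ c * ∫⁻ x in A, g x ∂μ) :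
    (1 - c) * ∫⁻ x in A, g x ∂μ ≤ ∫⁻ x in A \ B, g x ∂μ := by
  rw [ENNReal.sub_mul fun _ _ => hfin, one_mul, tsub_le_iff_left]
  calc ∫⁻ x in A, g x ∂μ ≤ ∫⁻ x in B ∪ A \ B, g x ∂μ :=
        lintegral_mono_set (by rw [union_sdiff_self]; exact subset_union_right)
    _ ≤ ∫⁻ x in B, g x ∂μ + ∫⁻ x in A \ B, g x ∂μ := lintegral_union_le _ _ _
    _ ≤ c * ∫⁻ x in A, g x ∂μ + ∫⁻ x in A \ B, g x ∂μ := by gcongr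

end Average

section DiscArea

theorem discArea_absolutelyContinuous : discArea ≪ volume :=
  (Measure.AbsolutelyContinuous.rfl.smul_left _).trans Measure.absolutelyContinuous_restrict

theorem setLIntegral_unitDisc_discArea (g : ℂ → ℝ≥0∞) :
    ∫⁻ z in unitDisc, g z ∂discArea = ENNReal.ofReal π⁻¹ * ∫⁻ z in unitDisc, g z := by
  rw [discArea, Measure.restrict_smul, lintegral_smul_measure, smul_eq_mul, unitDisc,
    Measure.restrict_restrict measurableSet_ball, inter_self]

theorem MemDHat.exists_setLIntegral_subaverageSet_le {ω : ℂ → ℝ} {r : ℝ} (hω : MemDHat ω)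
    (hr₀ : 0 < r) (hr₁ : r < 1) :
    ∃ C : ℝ≥0, 0 < C ∧ ∀ ν S, IsAveragingFamily r ν S → ∀ u, IsSubharmonicOn u unitDisc →
      ∀ ε : ℝ≥0, NullMeasurableSet (subaverageSet ν S ε u) volume →
        ∫⁻ z in subaverageSet ν S ε u, u z * ENNReal.ofReal (ω z) ∂discArea ≤
          C * ε * ∫⁻ z in unitDisc, u z * ENNReal.ofReal (ω z) ∂discArea := by
  obtain ⟨C, hC0, hC⟩ := hω.exists_setLIntegral_pseudoSup_le hr₀ hr₁
  refine ⟨C.toNNReal, toNNReal_pos.2 hC0, fun ν S hS u hu ε hE => ?_⟩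
  calc ∫⁻ z in subaverageSet ν S ε u, u z * ENNReal.ofReal (ω z) ∂discArea
      ≤ ε * ∫⁻ z in unitDisc, pseudoSup r u z * ENNReal.ofReal (ω z) ∂discArea :=
        hS.setLIntegral_subaverageSet_le (hE.mono_ac discArea_absolutelyContinuous) _
    _ ≤ ε * (ENNReal.ofReal π⁻¹ *
          (C.toNNReal * ∫⁻ z in unitDisc, u z * ENNReal.ofReal (ω z))) := by
        rw [setLIntegral_unitDisc_discArea]
        gcongr
        exact hC u hu
    _ = C.toNNReal * ε * ∫⁻ z in unitDisc, u z * ENNReal.ofReal (ω z) ∂discArea := by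
        rw [setLIntegral_unitDisc_discArea]
        ring

end DiscArea

end WeightedBergman

open WeightedBergman NNReal in
theorem mainTheorem7_general {ω : ℂ → ℝ} (hω : MemDHat ω) {r : ℝ} (hr₀ : 0 < r) (hr₁ : r < 1) :
    (∃ C : ℝ≥0, 0 < C ∧ ∀ ν S, IsAveragingFamily r ν S → ∀ u, IsSubharmonicOn u unitDisc →
      ∀ ε : ℝ≥0, NullMeasurableSet (subaverageSet ν S ε u) volume →
        ∫⁻ z in subaverageSet ν S ε u, u z * ENNReal.ofReal (ω z) ∂discArea ≤
          C * ε * ∫⁻ z in unitDisc, u z * ENNReal.ofReal (ω z) ∂discArea) ∧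
    (∃ ε₀ : ℝ≥0, 0 < ε₀ ∧ ∀ ν S, IsAveragingFamily r ν S → ∀ u, IsSubharmonicOn u unitDisc →
      ∀ ε ≤ ε₀, NullMeasurableSet (subaverageSet ν S ε u) volume →
        ∫⁻ z in unitDisc, u z * ENNReal.ofReal (ω z) ∂discArea ≠ ∞ →
        2⁻¹ * ∫⁻ z in unitDisc, u z * ENNReal.ofReal (ω z) ∂discArea ≤
          ∫⁻ z in unitDisc \ subaverageSet ν S ε u, u z * ENNReal.ofReal (ω z) ∂discArea) := by
  obtain ⟨C, hC0, hC⟩ := hω.exists_setLIntegral_subaverageSet_le hr₀ hr₁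
  refine ⟨⟨C, hC0, hC⟩, (2 * C)⁻¹, by positivity, fun ν S hS u hu ε hε hE hfin => ?_⟩
  have hhalf : (C * ε : ℝ≥0∞) ≤ 2⁻¹ := by
    rw [← ENNReal.coe_ofNat, ← ENNReal.coe_inv two_ne_zero]
    norm_cast
    calc C * ε ≤ C * (2 * C)⁻¹ := by gcongr
      _ = 2⁻¹ := by field_simp
  rw [← ENNReal.one_sub_inv_two]
  exact one_sub_mul_setLIntegral_le_setLIntegral_sdiff hfin <|
    (hC ν S hS u hu ε hE).trans (by gcongr)

theorem mainTheorem7 (ω : ℂ → ℝ) (hω : WeightedBergman.MemDHat ω)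
    (r : ℝ) (hr₀ : 0 < r) (hr₁ : r < 1) :
    (∃ C : ℝ, 0 < C ∧
      ∀ (p : ℝ), 0 < p →
      ∀ (ν : Measure ℂ) (S : ℂ → Set ℂ), WeightedBergman.IsAveragingFamily r ν S →
      ∀ (f : ℂ → ℂ), WeightedBergman.MemBergman p ω f →
      ∀ (ε : ℝ), 0 < ε →
        NullMeasurableSet (WeightedBergman.badSet p ν S ε f) volume →
        WeightedBergman.integralOver p ω f (WeightedBergman.badSet p ν S ε f) ≤
          ENNReal.ofReal (C * ε) * WeightedBergman.normPow p ω f) ∧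
    (∃ ε₀ : ℝ, 0 < ε₀ ∧
      ∀ (p : ℝ), 0 < p →
      ∀ (ν : Measure ℂ) (S : ℂ → Set ℂ), WeightedBergman.IsAveragingFamily r ν S →
      ∀ (f : ℂ → ℂ), WeightedBergman.MemBergman p ω f →
      ∀ (ε : ℝ), 0 < ε → ε ≤ ε₀ →
        NullMeasurableSet (WeightedBergman.badSet p ν S ε f) volume →
        WeightedBergman.IsDominatingFor p ω f
          (WeightedBergman.unitDisc \ WeightedBergman.badSet p ν S ε f)) := by
  obtain ⟨⟨C, hC0, hC⟩, ε₀, hε₀0, hε₀⟩ := mainTheorem7_general hω hr₀ hr₁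
  refine ⟨⟨C, hC0, fun p hp ν S hS f hf ε _ hE => ?_⟩,
    ε₀, hε₀0, fun p hp ν S hS f hf ε _ hε hE => ⟨Set.sdiff_subset, ?_, 2⁻¹, by norm_num, ?_⟩⟩
  · rw [WeightedBergman.badSet_eq_subaverageSet] at hE ⊢
    rw [ENNReal.ofReal_mul C.coe_nonneg, ENNReal.ofReal_coe_nnreal]
    exact hC ν S hS _ (hf.isSubharmonicOn hp) ε.toNNReal hE
  · exact measurableSet_ball.nullMeasurableSet.diff hE
  · rw [WeightedBergman.badSet_eq_subaverageSet] at hE ⊢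
    rw [ENNReal.ofReal_inv_of_pos two_pos, ENNReal.ofReal_ofNat]
    exact hε₀ ν S hS _ (hf.isSubharmonicOn hp) ε.toNNReal
      (Real.toNNReal_le_iff_le_coe.2 hε) hE hf.norm_finite.ne
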